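/- **Theorem 1.1.** For a metric space $(X,d)$ let $\overline X$ be its metric completion, $\partial X=\overline X\setminus X$, and $d(x)=\operatorname{dist}(x,\partial X)$. Assume that $(X,d)$ is unbounded, noncomplete, and that $d(x)>0$ for every $x\in X$ (that is, $X$ is open in $\overline X$); local compactness is not assumed. Let $$h(x,y)=2\log\frac{d(x,y)+\max\{d(x),d(y)\}}{\sqrt{d(x)d(y)}}$$ be Ibragimov's hyperbolization metric. Then $h$ is a metric on $X$, and $(X,h)$ is Gromov hyperbolic with constant $\log 4$ (where $\delta$-hyperbolic means $(x|y)_w\ge\min\{(x|z)_w,(z|y)_w\}-\delta$ for all $x,y,z,w$, with $(x|y)_w=\tfrac12[h(x,w)+h(y,w)-h(x,y)]$). Let $\partial_hX$ be the Gromov boundary of $(X,h)$, i.e. the set of equivalence classes of sequences $(x_i)$ in $X$ with $(x_i|x_j)_w\to\infty$ as $i,j\to\infty$, where $(x_i)\sim(y_i)$ if $(x_i|y_i)_w\to\infty$. For $a\in X$, $\zeta,\zeta'\in\partial_hX$ put $(a|\zeta)_w=\inf\liminf_i(a|z_i)_w$ and $(\zeta|\zeta')_w=\inf\liminf_i(z_i|z_i')_w$,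 the infima being over all $(z_i)\in\zeta$, $(z'_i)\in\zeta'$. For $\xi\in\partial_hX$, $\mathcal B_h(\xi)$ is the set of Busemann functions $b(x)=(\xi|w)_x-(\xi|x)_w$, $w\in X$. For $b\in\mathcal B_h(\xi)$ put $(x|y)_b=\tfrac12(b(x)+b(y)-h(x,y))$ for $x,y\in X$, $(\zeta|\zeta')_b=\inf\liminf_i(z_i|z'_i)_b$ over all $(z_i)\in\zeta$, $(z_i')\in\zeta'$, and, for $\varepsilon>0$ and $\zeta,\zeta'\in\partial_hX\setminus\{\xi\}$, $$h_{b,\varepsilon}(\zeta,\zeta')=\inf\sum_{i=1}^n e^{-\varepsilon(\zeta_{i-1}|\zeta_i)_b},$$ the infimum being over all $n\ge1$ and all chains $\zeta=\zeta_0,\dots,\zeta_n=\zeta'$ in $\partial_hX\setminus\{\xi\}$, with $e^{-\infty}=0$. There is a bijection $\psi:\partial_hX\to\partial X\cup\{\infty\}$ that is natural: the map $X\cup\partial_hX\to\overline X\cup\{\infty\}$ which is the identity on $X$ and $\psi$ on $\partial_hX$ is continuous. (Here $X\cup\partial_hX$ carries the topology in which $X$ is open with the topology of $h$ and the sets $\{y:(y|\zeta)_w>r\}$,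 $r\in\mathbb R$, form a neighbourhood base at $\zeta\in\partial_hX$; in $\overline X\cup\{\infty\}$ the set $\overline X$ is open with its metric topology and the neighbourhoods of $\infty$ are the sets containing $\infty$ whose complement is bounded.) Let $\xi=\psi^{-1}(\infty)$ and let $\varphi:\partial_hX\setminus\{\xi\}\to\partial X$ be the restriction of $\psi$. If $\varepsilon>0$ satisfies $e^{22\varepsilon\delta}\le2$ for some $\delta\ge0$ for which $(X,h)$ is $\delta$-hyperbolic, and $b\in\mathcal B_h(\xi)$, then $h_{b,\varepsilon}$ is a metric on $\partial_hX\setminus\{\xi\}$, and $$\varphi:(\partial_hX\setminus\{\xi\},h_{b,\varepsilon})\to(\partial X,d)$$ is an $\eta$-quasisymmetric homeomorphism with $\eta(t)=Ct^{1/\varepsilon}$, while $\varphi^{-1}$ is $\theta$-quasisymmetric with $\theta(t)=Ct^{\varepsilon}$; the constant $C>0$ depends only on $\varepsilon$. (A homeomorphism $f$ of metric spaces is $\eta$-quasisymmetric if $|x-y|\le t|x-z|$ implies $|f(x)-f(y)|\le\eta(t)|f(x)-f(z)|$ for all $t>0$ and all points $x,y,z$.) -/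

import Mathlib

open Filter Topology
open scoped NNReal ENNReal

noncomputable section

namespace Hyperbolization

/-! ### Distance functions, Gromov products, Gromov boundary

The notions of this section are attached to a distance function `m : X → X → ℝ`, because two
different metrics live on the same set `X`. -/

/-- `m` is a metric on `X`. -/
structure IsMetric {X : Type*} (m : X → X → ℝ) : Prop where
  self : ∀ x, m x x = 0
  eq_of_eq_zero : ∀ x y, m x y = 0 → x = y
  symm : ∀ x y, m x y = m y x
  triangle : ∀ x y z, m x z ≤ m x y + m y z

/-- The Gromov product `(x|y)_w`. -/
def gromovProd {X : Type*} (m : X → X → ℝ) (w x y : X) : ℝ :=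
  (m x w + m y w - m x y) / 2

/-- `(X, m)` is Gromov `δ`-hyperbolic. -/
def IsHyperbolic {X : Type*} (m : X → X → ℝ) (δ : ℝ) : Prop :=
  0 ≤ δ ∧ ∀ x y z w : X,
    min (gromovProd m w x z) (gromovProd m w z y) - δ ≤ gromovProd m w x y

/-- Gromov sequences: `(u i | u j)_w → ∞` as `i, j → ∞` (for every, equivalently for some,
base point `w`). -/
def IsGromovSeq {X : Type*} (m : X → X → ℝ) (u : ℕ → X) : Prop :=
  ∀ w : X, Tendsto (fun p : ℕ × ℕ => gromovProd m w (u p.1) (u p.2)) atTop atTop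

/-- Equivalence of Gromov sequences: `(u i | v i)_w → ∞`. -/
def GromovEquiv {X : Type*} (m : X → X → ℝ) (u v : ℕ → X) : Prop :=
  ∀ w : X, Tendsto (fun i : ℕ => gromovProd m w (u i) (v i)) atTop atTop

/-- The Gromov boundary `∂_m X`: the set of all equivalence classes of Gromov sequences. -/
def GromovBoundary {X : Type*} (m : X → X → ℝ) : Type _ :=
  {S : Set (ℕ → X) // ∃ u, IsGromovSeq m u ∧ S = {v | IsGromovSeq m v ∧ GromovEquiv m u v}}

/-- The Gromov sequences representing a boundary point. -/
def GromovBoundary.seqs {X : Type*} {m : X → X → ℝ} (ζ : GromovBoundary m) : Set (ℕ → X) :=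
  ζ.1

/-- The Gromov product `(a|ζ)_w` of a point and a boundary point. -/
def gromovProdPt {X : Type*} (m : X → X → ℝ) (w a : X) (ζ : GromovBoundary m) : EReal :=
  ⨅ v ∈ ζ.seqs, liminf (fun i => ((gromovProd m w a (v i) : ℝ) : EReal)) atTop

/-- The Gromov product `(ζ₁|ζ₂)_w` of two boundary points. -/
def gromovProdBd {X : Type*} (m : X → X → ℝ) (w : X) (ζ₁ ζ₂ : GromovBoundary m) : EReal :=
  ⨅ u ∈ ζ₁.seqs, ⨅ v ∈ ζ₂.seqs,
    liminf (fun i => ((gromovProd m w (u i) (v i) : ℝ) : EReal)) atTop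

/-! ### Busemann functions and Hamenstädt metrics -/

/-- The Busemann function `b_{ξ,w}(x) = (ξ|w)_x - (ξ|x)_w`; both products are finite, since
`0 ≤ (ξ|w)_x, (ξ|x)_w ≤ m x w`. -/
def busemann {X : Type*} (m : X → X → ℝ) (ξ : GromovBoundary m) (w x : X) : ℝ :=
  (gromovProdPt m x w ξ).toReal - (gromovProdPt m w x ξ).toReal

/-- `b ∈ 𝓑(ξ)`: `b` is a Busemann function based at `ξ`. -/
def IsBusemann {X : Type*} (m : X → X → ℝ) (ξ : GromovBoundary m) (b : X → ℝ) : Prop :=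
  ∃ w : X, ∀ x, b x = busemann m ξ w x

/-- The Gromov product `(x|y)_b = (b x + b y - m x y) / 2`. -/
def prodAt {X : Type*} (m : X → X → ℝ) (b : X → ℝ) (x y : X) : ℝ :=
  (b x + b y - m x y) / 2

/-- The Gromov product `(ζ₁|ζ₂)_b` of two boundary points. -/
def prodAtBd {X : Type*} (m : X → X → ℝ) (b : X → ℝ) (ζ₁ ζ₂ : GromovBoundary m) : EReal :=
  ⨅ u ∈ ζ₁.seqs, ⨅ v ∈ ζ₂.seqs,
    liminf (fun i => ((prodAt m b (u i) (v i) : ℝ) : EReal)) atTop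

/-- The punctured boundary `∂_m X ∖ {ξ}`. -/
abbrev PuncturedBoundary {X : Type*} (m : X → X → ℝ) (ξ : GromovBoundary m) : Type _ :=
  {ζ : GromovBoundary m // ζ ≠ ξ}

/-- `ρ_{b,ε}(ζ₁,ζ₂) = exp(-ε (ζ₁|ζ₂)_b)`, with `exp(-∞) = 0`. -/
def rhoAt {X : Type*} (m : X → X → ℝ) (b : X → ℝ) (ε : ℝ) (ζ₁ ζ₂ : GromovBoundary m) : ℝ≥0∞ :=
  EReal.exp (-((ε : EReal) * prodAtBd m b ζ₁ ζ₂))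

/-- The Hamenstädt distance `m_{b,ε}` on `∂_m X ∖ {ξ}`: the infimum of `∑ ρ_{b,ε}(c (i-1), c i)`
over finite chains `c 0, …, c n` in `∂_m X ∖ {ξ}`, `n ≥ 1`. -/
def hamenstadt {X : Type*} (m : X → X → ℝ) (ξ : GromovBoundary m) (b : X → ℝ) (ε : ℝ)
    (ζ₁ ζ₂ : PuncturedBoundary m ξ) : ℝ≥0∞ :=
  ⨅ (n : ℕ) (c : ℕ → PuncturedBoundary m ξ) (_ : 1 ≤ n ∧ c 0 = ζ₁ ∧ c n = ζ₂),
    ∑ i ∈ Finset.range n, rhoAt m b ε (c i).1 (c (i + 1)).1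

/-! ### The Gromov closure and its topology -/

/-- `X ∪ ∂_m X`. -/
inductive GromovClosure {X : Type*} (m : X → X → ℝ)
  | pt (x : X)
  | bd (ζ : GromovBoundary m)

/-- The Gromov product `(y|ζ)_w` for `y ∈ X ∪ ∂_m X` and `ζ ∈ ∂_m X`. -/
def closureProd {X : Type*} (m : X → X → ℝ) (w : X) (y : GromovClosure m)
    (ζ : GromovBoundary m) : EReal :=
  match y with
  | .pt a => gromovProdPt m w a ζ
  | .bd η => gromovProdBd m w η ζ

/-- The topology of `X ∪ ∂_m X`: `X` is open and carries the topology of the metric `m`, and the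
sets `{y | (y|ζ)_w > r}`, `r ∈ ℝ`, form a neighbourhood base at `ζ ∈ ∂_m X`. -/
instance {X : Type*} (m : X → X → ℝ) : TopologicalSpace (GromovClosure m) where
  IsOpen U :=
    (∀ x : X, GromovClosure.pt x ∈ U →
      ∃ r : ℝ, 0 < r ∧ ∀ y : X, m x y < r → GromovClosure.pt y ∈ U) ∧
    (∀ ζ : GromovBoundary m, GromovClosure.bd ζ ∈ U →
      ∀ w : X, ∃ r : ℝ, ∀ y : GromovClosure m, (r : EReal) < closureProd m w y ζ → y ∈ U)
  isOpen_univ := ⟨fun _ _ => ⟨1, one_pos, fun _ _ => trivial⟩, fun _ _ _ => ⟨0, fun _ _ => trivial⟩⟩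
  isOpen_inter := by
    rintro U V ⟨hU, hU'⟩ ⟨hV, hV'⟩
    refine ⟨fun x hx => ?_, fun ζ hζ w => ?_⟩
    · obtain ⟨r, hr, h⟩ := hU x hx.1
      obtain ⟨s, hs, h'⟩ := hV x hx.2
      exact ⟨min r s, lt_min hr hs, fun y hy =>
        ⟨h y (hy.trans_le (min_le_left _ _)), h' y (hy.trans_le (min_le_right _ _))⟩⟩
    · obtain ⟨r, h⟩ := hU' ζ hζ.1 w
      obtain ⟨s, h'⟩ := hV' ζ hζ.2 w
      refine ⟨max r s, fun y hy => ⟨h y (lt_of_le_of_lt ?_ hy), h' y (lt_of_le_of_lt ?_ hy)⟩⟩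
      · exact EReal.coe_le_coe_iff.2 (le_max_left _ _)
      · exact EReal.coe_le_coe_iff.2 (le_max_right _ _)
  isOpen_sUnion := by
    intro S hS
    refine ⟨?_, ?_⟩
    · rintro x ⟨U, hUS, hx⟩
      obtain ⟨r, hr, h⟩ := (hS U hUS).1 x hx
      exact ⟨r, hr, fun y hy => ⟨U, hUS, h y hy⟩⟩
    · rintro ζ ⟨U, hUS, hζ⟩ w
      obtain ⟨r, h⟩ := (hS U hUS).2 ζ hζ w
      exact ⟨r, fun y hy => ⟨U, hUS, h y hy⟩⟩

/-! ### Metric boundary, the point at infinity, natural maps -/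

/-- The metric boundary `∂X`: the complement of `X` in its metric completion. -/
def metricBoundary (X : Type*) [MetricSpace X] : Set (UniformSpace.Completion X) :=
  (Set.range ((↑) : X → UniformSpace.Completion X))ᶜ

/-- `d(x)`, the distance from `x` to `∂X`. -/
def boundaryDist {X : Type*} [MetricSpace X] (x : X) : ℝ :=
  Metric.infDist (x : UniformSpace.Completion X) (metricBoundary X)

/-- Ibragimov's hyperbolization metric. -/
def hypMetric {X : Type*} [MetricSpace X] (x y : X) : ℝ :=
  2 * Real.log ((dist x y + max (boundaryDist x) (boundaryDist y)) /
    Real.sqrt (boundaryDist x * boundaryDist y))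

/-- The completion of `X` with one point `∞` added. -/
inductive ExtendedCompletion (X : Type*) [MetricSpace X]
  | pt (a : UniformSpace.Completion X)
  | infty

/-- The topology of the completion of `X`, with the complements of bounded sets as neighbourhoods
of `∞`. -/
instance (X : Type*) [MetricSpace X] : TopologicalSpace (ExtendedCompletion X) where
  IsOpen U :=
    IsOpen {a : UniformSpace.Completion X | ExtendedCompletion.pt a ∈ U} ∧
    (ExtendedCompletion.infty ∈ U →
      Bornology.IsBounded {a : UniformSpace.Completion X | ExtendedCompletion.pt a ∉ U})
  isOpen_univ := by simp
  isOpen_inter := by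
    rintro U V ⟨hU, hU'⟩ ⟨hV, hV'⟩
    refine ⟨hU.inter hV, fun h => ((hU' h.1).union (hV' h.2)).subset fun a ha => ?_⟩
    by_cases h' : ExtendedCompletion.pt a ∈ U
    · exact Or.inr fun h'' => ha ⟨h', h''⟩
    · exact Or.inl h'
  isOpen_sUnion := by
    intro S hS
    refine ⟨?_, ?_⟩
    · have : {a : UniformSpace.Completion X | ExtendedCompletion.pt a ∈ ⋃₀ S} =
          ⋃ U ∈ S, {a : UniformSpace.Completion X | ExtendedCompletion.pt a ∈ U} := by
        ext a; simp
      rw [this]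
      exact isOpen_biUnion fun U hU => (hS U hU).1
    · rintro ⟨U, hUS, h⟩
      exact ((hS U hUS).2 h).subset fun a ha h' => ha ⟨U, hUS, h'⟩

/-- The identity of `X` extended by `ψ : ∂_m X → ∂X ∪ {∞}` (with `none` for `∞`), as a map from
`X ∪ ∂_m X` to the completion of `(X, d)` with `∞` added. -/
def extendId {X : Type*} [MetricSpace X] {m : X → X → ℝ}
    (ψ : GromovBoundary m → Option (metricBoundary X)) :
    GromovClosure m → ExtendedCompletion X
  | .pt x => .pt (x : UniformSpace.Completion X)
  | .bd ζ =>
    match ψ ζ with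
    | some a => .pt a.1
    | none => .infty

/-- `ψ : ∂_m X → ∂X ∪ {∞}` is natural: it extends the identity `(X, m) → (X, d)` continuously. -/
def IsNatural {X : Type*} [MetricSpace X] {m : X → X → ℝ}
    (ψ : GromovBoundary m → Option (metricBoundary X)) : Prop :=
  Continuous (extendId ψ)

/-! ### Quasisymmetric maps -/

/-- `η`-quasisymmetric maps, `η : [0,∞) → [0,∞)` a homeomorphism. -/
def IsQuasisymmetric {A B : Type*} [MetricSpace A] [MetricSpace B] (η : ℝ≥0 ≃ₜ ℝ≥0)
    (f : A → B) : Prop :=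
  IsHomeomorph f ∧ ∀ t : ℝ≥0, 0 < t → ∀ x y z : A,
    dist x y ≤ t * dist x z → dist (f x) (f y) ≤ η t * dist (f x) (f z)

end Hyperbolization

end

open Hyperbolization

/-!
Write `P(x,y) = d(x,y) + max (d(x), d(y))`, so that `h(x,y) = log (P(x,y)² / (d(x) d(y)))`. All
Gromov products of `h` are then explicit:
`exp (x|y)_w = P(x,w) P(y,w) / (P(x,y) d(w))` (`gromovProd_hypMetric`).
`P` is symmetric and satisfies the triangle inequality, hence the four-point inequality
`P(x,y) P(z,w) ≤ 4 max (P(x,z) P(y,w), P(x,w) P(y,z))`, which is hyperbolicity with constant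
`log 4` (`gauge_mul_gauge_le`).

The formula for the products shows that the Gromov sequences are exactly the sequences which
converge in the completion to a point of `∂X` or leave every bounded set (`IsGromovSeq.exists_tendsto`,
`tendsto_gromovProd_endFilter`), and that a point with a large Gromov product with points near such
an end is itself near that end (`exists_forall_lt_gromovProd_mem`). The first fact, with the second
to identify equivalent sequences, gives the bijection of `∂_h X` with `∂X ∪ {∞}`
(`boundaryEquiv`); the second gives its naturality.

`P` extends continuously to the completion, with `P(a,c) = d(a,c)` on `∂X`, and
`P(v,x) / P(v,y) → 1` as `v → ∞`. So the products and Busemann functions that the theorem involves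
are honest limits: a Busemann function at `∞` is `b(x) = log d(w) - log d(x)` (`busemann_infty`),
so that `(x|y)_b = log d(w) - log P(x,y)` and the Hamenstädt kernel is `(d(a,c) / d(w)) ^ ε` on
`∂X` (`rhoAt_busemann_infty`). Letting the fourth point tend to `∞` in the four-point
inequality of a `δ`-hyperbolic `h` gives `d(a,c) ≤ exp δ * max (d(a,e), d(e,c))` on `∂X`
(`dist_le_exp_mul_max`), and therefore, by Frink's lemma
(`exists_metricSpace_edist_eq_chainInf`), the chain metric is between one half of the kernel and
the kernel. A metric comparable in this way to a power of a multiple of `d` is quasisymmetrically equivalent to `d` (`isQuasisymmetric_of_dist_rpow`).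
-/

namespace Hyperbolization

section Gauge

variable {X : Type*} [MetricSpace X]

/-! ### The gauge of Ibragimov's metric -/

/-- The numerator `P(x,y) = d(x,y) + max (d(x), d(y))` of Ibragimov's metric. -/
noncomputable def gauge (x y : X) : ℝ :=
  dist x y + max (boundaryDist x) (boundaryDist y)

theorem boundaryDist_le_add (x y : X) : boundaryDist x ≤ boundaryDist y + dist x y := by
  have := Metric.infDist_le_infDist_add_dist (x := (x : UniformSpace.Completion X))
    (y := (y : UniformSpace.Completion X)) (s := metricBoundary X)
  rwa [UniformSpace.Completion.dist_eq] at this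

theorem gauge_comm (x y : X) : gauge x y = gauge y x := by
  rw [gauge, gauge, dist_comm, max_comm]

theorem gauge_self (x : X) : gauge x x = boundaryDist x := by simp [gauge]

theorem boundaryDist_le_gauge_left (x y : X) : boundaryDist x ≤ gauge x y :=
  (le_max_left _ _).trans (le_add_of_nonneg_left dist_nonneg)

theorem boundaryDist_le_gauge_right (x y : X) : boundaryDist y ≤ gauge x y :=
  (le_max_right _ _).trans (le_add_of_nonneg_left dist_nonneg)

theorem boundaryDist_nonneg (x : X) : 0 ≤ boundaryDist x := Metric.infDist_nonneg

theorem dist_le_gauge (x y : X) : dist x y ≤ gauge x y :=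
  le_add_of_nonneg_right ((boundaryDist_nonneg x).trans (le_max_left _ _))

theorem gauge_le (x y : X) : gauge x y ≤ 2 * dist x y + boundaryDist y := by
  have := boundaryDist_le_add x y
  have : max (boundaryDist x) (boundaryDist y) ≤ boundaryDist y + dist x y :=
    max_le this (le_add_of_nonneg_right dist_nonneg)
  rw [gauge]; linarith

/-- Unlike a metric, the gauge does not vanish on the diagonal, but it satisfies the triangle
inequality. -/
theorem gauge_triangle (x y z : X) : gauge x z ≤ gauge x y + gauge y z := by
  have h1 := dist_triangle x y z
  have h2 := le_max_left (boundaryDist x) (boundaryDist y)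
  have h3 := le_max_right (boundaryDist y) (boundaryDist z)
  have h4 := (boundaryDist_nonneg x).trans h2
  have h5 := (boundaryDist_nonneg z).trans h3
  have : max (boundaryDist x) (boundaryDist z) ≤
      max (boundaryDist x) (boundaryDist y) + max (boundaryDist y) (boundaryDist z) :=
    max_le (by linarith) (by linarith)
  rw [gauge, gauge, gauge]; linarith

theorem abs_gauge_sub_gauge_le (v x y : X) : |gauge v x - gauge v y| ≤ 2 * dist x y := by
  have key : ∀ x y : X, gauge v x ≤ gauge v y + 2 * dist x y := by
    intro x y
    have h1 := dist_triangle v y x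
    have h2 := boundaryDist_le_add x y
    have h3 := le_max_right (boundaryDist v) (boundaryDist y)
    have : max (boundaryDist v) (boundaryDist x) ≤
        max (boundaryDist v) (boundaryDist y) + dist x y :=
      max_le ((le_max_left _ _).trans (le_add_of_nonneg_right dist_nonneg)) (by linarith)
    rw [dist_comm y x] at h1
    rw [gauge, gauge]; linarith
  have h1 := key x y
  have h2 := key y x
  rw [dist_comm y x] at h2
  exact abs_le.2 ⟨by linarith, by linarith⟩

theorem gauge_pos (hX : ∀ x : X, 0 < boundaryDist x) (x y : X) : 0 < gauge x y :=
  (hX x).trans_le (boundaryDist_le_gauge_left x y)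

end Gauge

section Metric

variable {X : Type*} [MetricSpace X]

/-! ### Ibragimov's metric and its Gromov products -/

theorem hypMetric_eq (hX : ∀ x : X, 0 < boundaryDist x) (x y : X) :
    hypMetric x y =
      2 * Real.log (gauge x y) - Real.log (boundaryDist x) - Real.log (boundaryDist y) := by
  have hx := hX x
  have hy := hX y
  change 2 * Real.log (gauge x y / _) = _
  rw [Real.log_div (gauge_pos hX x y).ne' (Real.sqrt_pos.2 (mul_pos hx hy)).ne',
    Real.log_sqrt (mul_pos hx hy).le, Real.log_mul hx.ne' hy.ne']
  ring

theorem gromovProd_hypMetric (hX : ∀ x : X, 0 < boundaryDist x) (w x y : X) :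
    gromovProd hypMetric w x y = Real.log (gauge x w) + Real.log (gauge y w)
      - Real.log (gauge x y) - Real.log (boundaryDist w) := by
  rw [gromovProd, hypMetric_eq hX, hypMetric_eq hX, hypMetric_eq hX]
  ring

theorem lt_gromovProd_iff (hX : ∀ x : X, 0 < boundaryDist x) (r : ℝ) (w x y : X) :
    r < gromovProd hypMetric w x y ↔
      Real.exp r * boundaryDist w * gauge x y < gauge x w * gauge y w := by
  have h := gauge_pos hX
  rw [gromovProd_hypMetric hX, ← Real.log_mul (h x w).ne' (h y w).ne',
    ← Real.log_div (mul_pos (h x w) (h y w)).ne' (h x y).ne',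
    ← Real.log_div (div_pos (mul_pos (h x w) (h y w)) (h x y)).ne' (hX w).ne',
    Real.lt_log_iff_exp_lt (div_pos (div_pos (mul_pos (h x w) (h y w)) (h x y)) (hX w)),
    lt_div_iff₀ (hX w), lt_div_iff₀ (h x y)]

theorem isMetric_hypMetric (hX : ∀ x : X, 0 < boundaryDist x) :
    IsMetric (hypMetric (X := X)) where
  self x := by rw [hypMetric_eq hX, gauge_self]; ring
  eq_of_eq_zero x y h := by
    have hx := hX x
    have hy := hX y
    rw [hypMetric_eq hX, sub_sub, ← Real.log_mul hx.ne' hy.ne', sub_eq_zero] at h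
    have h2 : Real.log (gauge x y * gauge x y) = Real.log (boundaryDist x * boundaryDist y) := by
      rw [← h, Real.log_mul (gauge_pos hX x y).ne' (gauge_pos hX x y).ne']; ring
    have h3 := Real.log_injOn_pos (Set.mem_Ioi.2 (mul_pos (gauge_pos hX x y) (gauge_pos hX x y)))
      (Set.mem_Ioi.2 (mul_pos hx hy)) h2
    -- both factors `d(x)`, `d(y)` are at most `P(x,y)`, so equality forces both to be equal to it
    have h4 := boundaryDist_le_gauge_left x y
    have h5 := boundaryDist_le_gauge_right x y
    have h6 : gauge x y ≤ boundaryDist x := by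
      by_contra! hc
      have := mul_lt_mul'' hc hc hx.le hx.le
      nlinarith
    have h7 := le_max_left (boundaryDist x) (boundaryDist y)
    rw [gauge] at h6
    exact dist_le_zero.1 (by linarith)
  symm x y := by rw [hypMetric_eq hX, hypMetric_eq hX, gauge_comm]; ring
  triangle x y z := by
    have h := gauge_pos hX
    suffices gauge x z * boundaryDist y ≤ gauge x y * gauge y z by
      have := Real.log_le_log (mul_pos (h x z) (hX y)) this
      rw [Real.log_mul (h x z).ne' (hX y).ne', Real.log_mul (h x y).ne' (h y z).ne'] at this
      rw [hypMetric_eq hX, hypMetric_eq hX, hypMetric_eq hX]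
      linarith
    have hd := dist_triangle x y z
    have h1 := le_max_left (boundaryDist x) (boundaryDist y)
    have h2 := le_max_right (boundaryDist x) (boundaryDist y)
    have h3 := le_max_left (boundaryDist y) (boundaryDist z)
    have h4 := le_max_right (boundaryDist y) (boundaryDist z)
    have hy := hX y
    simp only [gauge]
    generalize max (boundaryDist x) (boundaryDist y) = a at *
    generalize max (boundaryDist y) (boundaryDist z) = b at *
    have h5 : max (boundaryDist x) (boundaryDist z) * boundaryDist y ≤ a * b := by
      rw [max_mul_of_nonneg _ _ hy.le]
      refine max_le (mul_le_mul h1 h3 hy.le (hy.le.trans h2)) ?_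
      rw [mul_comm a b]
      exact mul_le_mul h4 h2 hy.le (hy.le.trans h3)
    have h6 := mul_le_mul_of_nonneg_right hd hy.le
    have h7 := mul_le_mul_of_nonneg_left h3 (dist_nonneg (x := x) (y := y))
    have h8 := mul_le_mul_of_nonneg_left h2 (dist_nonneg (x := y) (y := z))
    have h9 := mul_nonneg (dist_nonneg (x := x) (y := y)) (dist_nonneg (x := y) (y := z))
    linarith

/-- In terms of the gauge, hyperbolicity is a multiplicative four-point inequality in which the
base point plays the same role as the other points. -/
theorem min_gromovProd_sub_le_iff (hX : ∀ x : X, 0 < boundaryDist x) (δ : ℝ) (x y z w : X) :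
    min (gromovProd hypMetric w x z) (gromovProd hypMetric w z y) - δ ≤ gromovProd hypMetric w x y ↔
      gauge x y * gauge z w ≤
        Real.exp δ * max (gauge x z * gauge y w) (gauge x w * gauge y z) := by
  have h := gauge_pos hX
  have key : ∀ a b c d e f g i : X,
      gauge a b * gauge c d ≤ Real.exp δ * (gauge e f * gauge g i) ↔
      Real.log (gauge a b) + Real.log (gauge c d) ≤
        δ + Real.log (gauge e f) + Real.log (gauge g i) := by
    intro a b c d e f g i
    rw [← Real.log_le_log_iff (mul_pos (h _ _) (h _ _))
        (mul_pos (Real.exp_pos _) (mul_pos (h _ _) (h _ _))), Real.log_mul (h _ _).ne' (h _ _).ne',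
      Real.log_mul (Real.exp_pos _).ne' (mul_pos (h _ _) (h _ _)).ne', Real.log_exp,
      Real.log_mul (h _ _).ne' (h _ _).ne', add_assoc]
  rw [mul_max_of_nonneg _ _ (Real.exp_pos δ).le, le_max_iff, key, key, sub_le_iff_le_add,
    min_le_iff, gromovProd_hypMetric hX, gromovProd_hypMetric hX, gromovProd_hypMetric hX,
    gauge_comm z y]
  constructor
  · rintro (H | H)
    · exact Or.inl (by linarith)
    · exact Or.inr (by linarith)
  · rintro (H | H)
    · exact Or.inl (by linarith)
    · exact Or.inr (by linarith)

/-- The four-point inequality with constant `4`, which every symmetric nonnegative function with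
the triangle inequality satisfies. -/
theorem gauge_mul_gauge_le (x y z w : X) :
    gauge x y * gauge z w ≤ 4 * max (gauge x z * gauge y w) (gauge x w * gauge y z) := by
  have h0 : ∀ a b : X, 0 ≤ gauge a b := fun a b => dist_nonneg.trans (dist_le_gauge a b)
  have t1 := gauge_triangle x z y
  have t2 := gauge_triangle x w y
  have t3 := gauge_triangle z x w
  have t4 := gauge_triangle z y w
  rw [gauge_comm z y] at t1 t4
  rw [gauge_comm w y] at t2
  rw [gauge_comm z x] at t3
  rw [mul_max_of_nonneg _ _ (by norm_num : (0 : ℝ) ≤ 4), le_max_iff]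
  have prod : ∀ p q : ℝ, 0 ≤ p → gauge x y ≤ 2 * p → gauge z w ≤ 2 * q →
      gauge x y * gauge z w ≤ 4 * (p * q) := fun p q hp h1 h2 =>
    (mul_le_mul h1 h2 (h0 _ _) (by linarith)).trans_eq (by ring)
  -- the side opposite to the smallest of the four sides of the quadrilateral `x, z, y, w`
  -- determines which of the two products is large
  rcases le_total (gauge x z) (gauge y w) with h1 | h1 <;>
  rcases le_total (gauge x w) (gauge y z) with h2 | h2
  · rcases le_total (gauge x z) (gauge x w) with h3 | h3
    · right
      rw [mul_comm (gauge x w)]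
      exact prod _ _ (h0 _ _) (by linarith) (by linarith)
    · left
      rw [mul_comm (gauge x z)]
      exact prod _ _ (h0 _ _) (by linarith) (by linarith)
  · rcases le_total (gauge x z) (gauge y z) with h3 | h3
    · right
      rw [mul_comm (gauge x w)]
      exact prod _ _ (h0 _ _) (by linarith) (by linarith)
    · left
      exact prod _ _ (h0 _ _) (by linarith) (by linarith)
  · rcases le_total (gauge y w) (gauge x w) with h3 | h3
    · right
      exact prod _ _ (h0 _ _) (by linarith) (by linarith)
    · left
      rw [mul_comm (gauge x z)]
      exact prod _ _ (h0 _ _) (by linarith) (by linarith)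
  · rcases le_total (gauge y w) (gauge y z) with h3 | h3
    · right
      exact prod _ _ (h0 _ _) (by linarith) (by linarith)
    · left
      exact prod _ _ (h0 _ _) (by linarith) (by linarith)

theorem isHyperbolic_hypMetric (hX : ∀ x : X, 0 < boundaryDist x) :
    IsHyperbolic (hypMetric (X := X)) (Real.log 4) := by
  refine ⟨Real.log_nonneg (by norm_num), fun x y z w => ?_⟩
  rw [min_gromovProd_sub_le_iff hX, Real.exp_log (by norm_num)]
  exact gauge_mul_gauge_le x y z w

end Metric

section Ends

variable {X : Type*} [MetricSpace X]

/-! ### Ends: the filters on `X` at the points of `∂X ∪ {∞}` -/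

/-- The filter on `X` of neighbourhoods of a point of `∂X ∪ {∞}`, where `none` stands for `∞`:
the trace on `X` of the neighbourhoods of a boundary point, and the complements of bounded sets
for `∞`. -/
def endFilter : Option (metricBoundary X) → Filter X
  | some a => comap (↑) (𝓝 (a : UniformSpace.Completion X))
  | none => Bornology.cobounded X

theorem endFilter_neBot (hb : ¬ Bornology.IsBounded (Set.univ : Set X)) :
    ∀ o : Option (metricBoundary X), (endFilter o).NeBot
  | some _ => UniformSpace.Completion.isDenseInducing_coe.comap_nhds_neBot _
  | none => neBot_iff.2 fun h => hb (by
    have := Bornology.cobounded_eq_bot_iff.1 h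
    exact Bornology.IsBounded.all _)

theorem exists_seq_tendsto_endFilter (hb : ¬ Bornology.IsBounded (Set.univ : Set X))
    (o : Option (metricBoundary X)) : ∃ u : ℕ → X, Tendsto u atTop (endFilter o) := by
  have := endFilter_neBot hb o
  have : (endFilter o).IsCountablyGenerated := by
    cases o with
    | some a => exact inferInstanceAs (comap _ (𝓝 _)).IsCountablyGenerated
    | none =>
      have : Nonempty X := by
        by_contra h
        rw [not_nonempty_iff] at h
        exact hb ((Set.univ_eq_empty_iff.2 h).symm ▸ Bornology.isBounded_empty)
      obtain ⟨c⟩ := this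
      have h : (comap (dist c) atTop).IsCountablyGenerated := inferInstance
      rwa [Metric.comap_dist_left_atTop] at h
  exact exists_seq_tendsto _

theorem tendsto_endFilter_some {α : Type*} {l : Filter α} {u : α → X} {a : metricBoundary X} :
    Tendsto u l (endFilter (some a)) ↔
      Tendsto (fun i => (u i : UniformSpace.Completion X)) l (𝓝 (a : UniformSpace.Completion X)) :=
  tendsto_comap_iff

theorem tendsto_endFilter_none {α : Type*} {l : Filter α} {u : α → X} (w : X) :
    Tendsto u l (endFilter none) ↔ Tendsto (fun i => dist (u i) w) l atTop :=
  (Metric.tendsto_dist_right_atTop_iff w).symm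

theorem tendsto_dist_endFilter_some (a : metricBoundary X) (w : X) :
    Tendsto (fun x : X => dist x w) (endFilter (some a))
      (𝓝 (dist (a : UniformSpace.Completion X) w)) := by
  have h := (tendsto_endFilter_some.1 (tendsto_id (x := endFilter (some a)))).dist
    (tendsto_const_nhds (x := (w : UniformSpace.Completion X)))
  simpa only [UniformSpace.Completion.dist_eq, id] using h

theorem tendsto_dist_endFilter_none (w : X) :
    Tendsto (fun x : X => dist x w) (endFilter none) atTop :=
  (tendsto_endFilter_none w).1 tendsto_id

theorem eq_of_tendsto_endFilter {α : Type*} {l : Filter α} [l.NeBot] {u : α → X}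
    {o o' : Option (metricBoundary X)} (h : Tendsto u l (endFilter o))
    (h' : Tendsto u l (endFilter o')) : o = o' := by
  have key : ∀ a : metricBoundary X, Tendsto u l (endFilter (some a)) →
      Tendsto u l (endFilter none) → False := by
    intro a ha hn
    obtain ⟨i⟩ := l.nonempty_of_neBot
    exact not_tendsto_nhds_of_tendsto_atTop ((tendsto_endFilter_none (u i)).1 hn) _
      ((tendsto_dist_endFilter_some a (u i)).comp ha)
  match o, o' with
  | some a, some b =>
    exact congrArg some (Subtype.ext (tendsto_nhds_unique (tendsto_endFilter_some.1 h)
      (tendsto_endFilter_some.1 h')))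
  | some a, none => exact (key a h h').elim
  | none, some a => exact (key a h' h).elim
  | none, none => rfl

theorem tendsto_boundaryDist_endFilter (a : metricBoundary X) :
    Tendsto (boundaryDist (X := X)) (endFilter (some a)) (𝓝 0) := by
  rw [← Metric.infDist_zero_of_mem a.2]
  exact ((Metric.continuous_infDist_pt (metricBoundary X)).tendsto _).comp
    (tendsto_endFilter_some.1 tendsto_id)

theorem mem_metricBoundary_of_infDist_eq_zero (hX : ∀ x : X, 0 < boundaryDist x)
    {a : UniformSpace.Completion X} (ha : Metric.infDist a (metricBoundary X) = 0) :
    a ∈ metricBoundary X := by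
  rintro ⟨x, rfl⟩
  exact (hX x).ne' ha

theorem tendsto_gauge_left (a : metricBoundary X) (w : X) :
    Tendsto (fun x => gauge x w) (endFilter (some a))
      (𝓝 (dist (a : UniformSpace.Completion X) w + boundaryDist w)) := by
  have := (tendsto_dist_endFilter_some a w).add
    ((tendsto_boundaryDist_endFilter a).max (tendsto_const_nhds (x := boundaryDist w)))
  rwa [max_eq_right (boundaryDist_nonneg w)] at this

theorem tendsto_gauge_boundary (a c : metricBoundary X) :
    Tendsto (fun p : X × X => gauge p.1 p.2) (endFilter (some a) ×ˢ endFilter (some c))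
      (𝓝 (dist a c)) := by
  have h1 : Tendsto (fun p : X × X => dist p.1 p.2) (endFilter (some a) ×ˢ endFilter (some c))
      (𝓝 (dist a c)) := by
    have h := (tendsto_endFilter_some.1 (tendsto_fst (f := endFilter (some a))
      (g := endFilter (some c)))).dist (tendsto_endFilter_some.1 tendsto_snd)
    simpa only [UniformSpace.Completion.dist_eq, Subtype.dist_eq] using h
  have := h1.add (((tendsto_boundaryDist_endFilter a).comp tendsto_fst).max
    ((tendsto_boundaryDist_endFilter c).comp tendsto_snd))
  rwa [max_self, add_zero] at this

theorem tendsto_gauge_infty (w : X) : Tendsto (fun x => gauge x w) (endFilter none) atTop :=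
  tendsto_atTop_mono (fun x => dist_le_gauge x w) (tendsto_dist_endFilter_none w)

theorem tendsto_gauge_div_gauge (hX : ∀ x : X, 0 < boundaryDist x) (x y : X) :
    Tendsto (fun v => gauge v x / gauge v y) (endFilter none) (𝓝 1) := by
  have h : Tendsto (fun v => 2 * dist x y / gauge v y) (endFilter none) (𝓝 0) :=
    tendsto_const_nhds.div_atTop (tendsto_gauge_infty y)
  rw [tendsto_iff_norm_sub_tendsto_zero]
  refine squeeze_zero (fun _ => norm_nonneg _) (fun v => ?_) h
  have hv := gauge_pos hX v y
  rw [Real.norm_eq_abs, div_sub_one hv.ne', abs_div, abs_of_pos hv]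
  exact div_le_div_of_nonneg_right (abs_gauge_sub_gauge_le v x y) hv.le

/-! ### Gromov sequences are the sequences that converge to an end -/

theorem tendsto_gromovProd_endFilter (hX : ∀ x : X, 0 < boundaryDist x) (w : X)
    (o : Option (metricBoundary X)) :
    Tendsto (fun p : X × X => gromovProd hypMetric w p.1 p.2) (endFilter o ×ˢ endFilter o)
      atTop := by
  have h := gauge_pos hX
  cases o with
  | some a =>
    have h0 : Tendsto (fun p : X × X => Real.log (gauge p.1 p.2))
        (endFilter (some a) ×ˢ endFilter (some a)) atBot := by
      refine Real.tendsto_log_nhdsGT_zero.comp (tendsto_nhdsWithin_iff.2 ⟨?_, ?_⟩)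
      · simpa using tendsto_gauge_boundary a a
      · exact Eventually.of_forall fun p => h p.1 p.2
    refine tendsto_atTop_mono (fun p => ?_)
      (tendsto_atTop_add_const_left _ (Real.log (boundaryDist w)) (tendsto_neg_atBot_atTop.comp h0))
    have h1 := Real.log_le_log (hX w) (boundaryDist_le_gauge_right p.1 w)
    have h2 := Real.log_le_log (hX w) (boundaryDist_le_gauge_right p.2 w)
    rw [gromovProd_hypMetric hX, Function.comp_apply]
    linarith
  | none =>
    have hl := Real.tendsto_log_atTop.comp (tendsto_gauge_infty w)
    have h0 := tendsto_inf_atTop _ (hl.comp (tendsto_fst (g := endFilter none)))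
      (hl.comp (tendsto_snd (f := endFilter none)))
    refine tendsto_atTop_mono (fun p => ?_)
      (tendsto_atTop_add_const_right _ (-Real.log 2 - Real.log (boundaryDist w)) h0)
    rw [gromovProd_hypMetric hX]
    have ht := gauge_triangle p.1 w p.2
    rw [gauge_comm w] at ht
    simp only [Function.comp_apply]
    rcases le_total (gauge p.1 w) (gauge p.2 w) with h1 | h1
    · have h2 := Real.log_le_log (h _ _) (show gauge p.1 p.2 ≤ 2 * gauge p.2 w by linarith)
      rw [Real.log_mul two_ne_zero (h _ _).ne'] at h2
      have h3 := min_le_left (Real.log (gauge p.1 w)) (Real.log (gauge p.2 w))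
      linarith
    · have h2 := Real.log_le_log (h _ _) (show gauge p.1 p.2 ≤ 2 * gauge p.1 w by linarith)
      rw [Real.log_mul two_ne_zero (h _ _).ne'] at h2
      have h3 := min_le_right (Real.log (gauge p.1 w)) (Real.log (gauge p.2 w))
      linarith

/-- A point whose Gromov product with points near an end is large is itself near that end. This
carries the naturality of the identification of `∂_h X` with `∂X ∪ {∞}`, and also shows that
sequences equivalent to a convergent one have the same limit. -/
theorem exists_forall_lt_gromovProd_mem (hX : ∀ x : X, 0 < boundaryDist x) (w : X)
    (o : Option (metricBoundary X)) {V : Set X} (hV : V ∈ endFilter o) :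
    ∃ r : ℝ, ∀ᶠ y in endFilter o, ∀ x, r < gromovProd hypMetric w x y → x ∈ V := by
  have hw := hX w
  have h := gauge_pos hX
  -- `r` is chosen so that `exp r * d(w)` takes a given value
  have hr : ∀ B : ℝ, 0 < B → Real.exp (Real.log (B / boundaryDist w)) * boundaryDist w = B := by
    intro B hB
    rw [Real.exp_log (div_pos hB hw), div_mul_cancel₀ _ hw.ne']
  cases o with
  | some a =>
    obtain ⟨U, hU, hUV⟩ := hV
    obtain ⟨s, hs, hsU⟩ := Metric.mem_nhds_iff.1 hU
    set M := dist (a : UniformSpace.Completion X) w + boundaryDist w + 1 with hM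
    have hM0 : 0 < M := by positivity
    have hev1 : ∀ᶠ y in endFilter (some a), gauge y w < M :=
      (tendsto_gauge_left a w).eventually_lt_const (by linarith)
    have hev2 : ∀ᶠ y : X in endFilter (some a), dist (y : UniformSpace.Completion X) a < s / 2 :=
      preimage_mem_comap (Metric.ball_mem_nhds _ (half_pos hs))
    have hB : 0 < M + 2 * M ^ 2 / s := by positivity
    refine ⟨Real.log ((M + 2 * M ^ 2 / s) / boundaryDist w), ?_⟩
    filter_upwards [hev1, hev2] with y hy1 hy2 x hx
    rw [lt_gromovProd_iff hX, hr _ hB] at hx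
    apply hUV
    apply hsU
    rw [Metric.mem_ball]
    have h1 := gauge_triangle x y w
    have hxy := h x y
    have h2 : gauge x w * gauge y w ≤ (gauge x y + M) * M :=
      mul_le_mul (by linarith) hy1.le (h y w).le (by linarith)
    have h3 : 2 * M ^ 2 / s * gauge x y < M ^ 2 := by linarith
    have h4 : gauge x y < s / 2 := by
      have e : 2 * M ^ 2 / s * gauge x y = M ^ 2 * (gauge x y * (2 / s)) := by ring
      rw [e] at h3
      have h5 : gauge x y * (2 / s) < 1 := by
        by_contra! hc
        have := mul_le_mul_of_nonneg_left hc (sq_nonneg M)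
        linarith
      rw [mul_div_assoc', div_lt_one hs] at h5
      linarith
    have h6 := dist_triangle (x : UniformSpace.Completion X) y a
    rw [UniformSpace.Completion.dist_eq] at h6
    have h7 := dist_le_gauge x y
    linarith
  | none =>
    obtain ⟨R, hR⟩ : ∃ R, ∀ x ∉ V, dist x w ≤ R :=
      (Metric.isBounded_iff_subset_closedBall w).1 (Bornology.isBounded_def.2 (by
        rw [compl_compl]; exact hV : Vᶜᶜ ∈ Bornology.cobounded X))
    set B := 2 * max R 0 + boundaryDist w with hB
    have hB0 : 0 < B := by positivity
    refine ⟨Real.log (2 * B / boundaryDist w), ?_⟩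
    filter_upwards [(tendsto_gauge_infty w).eventually_ge_atTop (2 * B)] with y hy x hx
    rw [lt_gromovProd_iff hX, hr _ (by positivity)] at hx
    by_contra hxV
    have h1 : gauge x w ≤ B := by
      have := gauge_le x w
      have := (hR x hxV).trans (le_max_left R 0)
      linarith
    have h2 := mul_le_mul_of_nonneg_right h1 (h y w).le
    have h3 : 2 * gauge x y < gauge y w := by
      by_contra! hc
      have := mul_le_mul_of_nonneg_left hc hB0.le
      linarith
    have h4 := gauge_triangle y x w
    rw [gauge_comm y x] at h4
    linarith

theorem tendsto_of_gromovEquiv (hX : ∀ x : X, 0 < boundaryDist x) {u v : ℕ → X}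
    {o : Option (metricBoundary X)} (hu : Tendsto u atTop (endFilter o))
    (h : GromovEquiv hypMetric u v) : Tendsto v atTop (endFilter o) := by
  intro V hV
  obtain ⟨r, hr⟩ := exists_forall_lt_gromovProd_mem hX (u 0) o hV
  rw [mem_map]
  filter_upwards [hu.eventually hr, (h (u 0)).eventually_gt_atTop r] with i h1 h2
  refine h1 _ (h2.trans_eq ?_)
  rw [gromovProd_hypMetric hX, gromovProd_hypMetric hX, gauge_comm (u i) (v i)]
  ring

theorem isGromovSeq_of_tendsto (hX : ∀ x : X, 0 < boundaryDist x) {u : ℕ → X}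
    {o : Option (metricBoundary X)} (hu : Tendsto u atTop (endFilter o)) :
    IsGromovSeq hypMetric u := by
  intro w
  have h := (tendsto_gromovProd_endFilter hX w o).comp (hu.prodMap hu)
  rwa [prod_atTop_atTop_eq] at h

theorem gromovEquiv_of_tendsto (hX : ∀ x : X, 0 < boundaryDist x) {u v : ℕ → X}
    {o : Option (metricBoundary X)} (hu : Tendsto u atTop (endFilter o))
    (hv : Tendsto v atTop (endFilter o)) : GromovEquiv hypMetric u v := by
  intro w
  have h := (tendsto_gromovProd_endFilter hX w o).comp (hu.prodMk hv)
  exact h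

/-- A Gromov sequence that does not tend to infinity is bounded, and then it is Cauchy and the
distances of its terms to `∂X` tend to zero. -/
theorem IsGromovSeq.exists_tendsto (hX : ∀ x : X, 0 < boundaryDist x) {u : ℕ → X}
    (hu : IsGromovSeq hypMetric u) : ∃ o, Tendsto u atTop (endFilter o) := by
  by_cases hinf : Tendsto u atTop (endFilter none)
  · exact ⟨none, hinf⟩
  set w := u 0
  have hw := hX w
  have h := gauge_pos hX
  have hlarge : ∀ K : ℝ, 0 < K → ∃ N, ∀ i j, N ≤ i → N ≤ j →
      K * gauge (u i) (u j) < gauge (u i) w * gauge (u j) w := by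
    intro K hK
    have := (hu w).eventually_gt_atTop (Real.log (K / boundaryDist w))
    rw [eventually_atTop] at this
    obtain ⟨⟨a, b⟩, hab⟩ := this
    refine ⟨max a b, fun i j hi hj => ?_⟩
    have := hab (i, j) ⟨(le_max_left _ _).trans hi, (le_max_right _ _).trans hj⟩
    rwa [lt_gromovProd_iff hX, Real.exp_log (div_pos hK hw), div_mul_cancel₀ _ hw.ne'] at this
  obtain ⟨B, hB0, N₀, hN₀⟩ : ∃ B, 0 < B ∧ ∃ N₀, ∀ i ≥ N₀, gauge (u i) w ≤ B := by
    rw [tendsto_endFilter_none w, tendsto_atTop] at hinf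
    push Not at hinf
    obtain ⟨R, hR⟩ := hinf
    set B := 2 * max R 0 + boundaryDist w
    have hB0 : 0 < B := by positivity
    obtain ⟨N, hN⟩ := hlarge (2 * B) (by positivity)
    obtain ⟨j, hj, hjR⟩ := frequently_atTop.1 hR N
    have hjB : gauge (u j) w ≤ B := by
      have := gauge_le (u j) w
      have := le_max_left R 0
      linarith
    refine ⟨2 * B, by positivity, N, fun i hi => ?_⟩
    have h1 := hN i j hi hj
    have h2 := mul_le_mul_of_nonneg_left hjB (h (u i) w).le
    have h3 : 2 * gauge (u i) (u j) < gauge (u i) w := by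
      by_contra! hc
      have := mul_le_mul_of_nonneg_left hc hB0.le
      linarith
    have h4 := gauge_triangle (u i) (u j) w
    linarith
  have hsmall : ∀ s : ℝ, 0 < s → ∃ N, ∀ i j, N ≤ i → N ≤ j → gauge (u i) (u j) < s := by
    intro s hs
    obtain ⟨N, hN⟩ := hlarge (B ^ 2 / s) (by positivity)
    refine ⟨max N N₀, fun i j hi hj => ?_⟩
    have h1 := hN i j ((le_max_left _ _).trans hi) ((le_max_left _ _).trans hj)
    have h2 := mul_le_mul (hN₀ i ((le_max_right _ _).trans hi))
      (hN₀ j ((le_max_right _ _).trans hj)) (h _ _).le hB0.le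
    by_contra! hc
    have h3 := mul_le_mul_of_nonneg_left hc (show 0 ≤ B ^ 2 / s by positivity)
    rw [div_mul_cancel₀ _ hs.ne'] at h3
    nlinarith
  have hc : CauchySeq fun i => (u i : UniformSpace.Completion X) := by
    refine Metric.cauchySeq_iff.2 fun s hs => ?_
    obtain ⟨N, hN⟩ := hsmall s hs
    refine ⟨N, fun i hi j hj => ?_⟩
    rw [UniformSpace.Completion.dist_eq]
    exact (dist_le_gauge _ _).trans_lt (hN i j hi hj)
  obtain ⟨a, ha⟩ := cauchySeq_tendsto_of_complete hc
  have hd : Tendsto (fun i => boundaryDist (u i)) atTop (𝓝 0) := by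
    refine Metric.tendsto_atTop.2 fun s hs => ?_
    obtain ⟨N, hN⟩ := hsmall s hs
    refine ⟨N, fun i hi => ?_⟩
    rw [Real.dist_0_eq_abs, abs_of_nonneg (boundaryDist_nonneg _), ← gauge_self]
    exact hN i i hi hi
  have ha0 := tendsto_nhds_unique
    (((Metric.continuous_infDist_pt (metricBoundary X)).tendsto a).comp ha) hd
  exact ⟨some ⟨a, mem_metricBoundary_of_infDist_eq_zero hX ha0⟩, tendsto_endFilter_some.2 ha⟩

/-- The point of the Gromov boundary at an end: the class of all sequences converging to it. -/
def boundaryPoint (hb : ¬ Bornology.IsBounded (Set.univ : Set X))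
    (hX : ∀ x : X, 0 < boundaryDist x) (o : Option (metricBoundary X)) :
    GromovBoundary (hypMetric (X := X)) :=
  ⟨{v | Tendsto v atTop (endFilter o)}, by
    obtain ⟨u, hu⟩ := exists_seq_tendsto_endFilter hb o
    refine ⟨u, isGromovSeq_of_tendsto hX hu, Set.ext fun v => ⟨fun hv => ?_, fun hv => ?_⟩⟩
    · exact ⟨isGromovSeq_of_tendsto hX hv, gromovEquiv_of_tendsto hX hu hv⟩
    · exact tendsto_of_gromovEquiv hX hu hv.2⟩

theorem mem_seqs_boundaryPoint (hb : ¬ Bornology.IsBounded (Set.univ : Set X))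
    (hX : ∀ x : X, 0 < boundaryDist x) (o : Option (metricBoundary X)) (v : ℕ → X) :
    v ∈ (boundaryPoint hb hX o).seqs ↔ Tendsto v atTop (endFilter o) := Iff.rfl

theorem bijective_boundaryPoint (hb : ¬ Bornology.IsBounded (Set.univ : Set X))
    (hX : ∀ x : X, 0 < boundaryDist x) : Function.Bijective (boundaryPoint hb hX) := by
  refine ⟨fun o o' h => ?_, ?_⟩
  · obtain ⟨u, hu⟩ := exists_seq_tendsto_endFilter hb o
    refine eq_of_tendsto_endFilter hu ?_
    rwa [← mem_seqs_boundaryPoint hb hX, ← h]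
  · rintro ⟨S, u, hu, rfl⟩
    obtain ⟨o, ho⟩ := hu.exists_tendsto hX
    refine ⟨o, Subtype.ext (Set.ext fun v => ⟨fun hv => ?_, fun hv => ?_⟩)⟩
    · exact ⟨isGromovSeq_of_tendsto hX hv, gromovEquiv_of_tendsto hX ho hv⟩
    · exact tendsto_of_gromovEquiv hX ho hv.2

/-- The natural bijection between the Gromov boundary of `(X, h)` and `∂X ∪ {∞}`. -/
noncomputable def boundaryEquiv (hb : ¬ Bornology.IsBounded (Set.univ : Set X))
    (hX : ∀ x : X, 0 < boundaryDist x) :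
    GromovBoundary (hypMetric (X := X)) ≃ Option (metricBoundary X) :=
  (Equiv.ofBijective _ (bijective_boundaryPoint hb hX)).symm

theorem mem_seqs_iff (hb : ¬ Bornology.IsBounded (Set.univ : Set X))
    (hX : ∀ x : X, 0 < boundaryDist x) (ζ : GromovBoundary (hypMetric (X := X))) (v : ℕ → X) :
    v ∈ ζ.seqs ↔ Tendsto v atTop (endFilter (boundaryEquiv hb hX ζ)) := by
  rw [← mem_seqs_boundaryPoint hb hX]
  exact iff_of_eq (congrArg (v ∈ GromovBoundary.seqs ·)
    ((Equiv.ofBijective _ (bijective_boundaryPoint hb hX)).apply_symm_apply ζ).symm)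

end Ends

section Naturality

variable {X : Type*} [MetricSpace X]

/-! ### Naturality -/

/-- The `h`-topology is finer than (in fact equal to) the `d`-topology. -/
theorem exists_forall_hypMetric_lt (hX : ∀ x : X, 0 < boundaryDist x) (x : X) {s : ℝ}
    (hs : 0 < s) : ∃ r > 0, ∀ y, hypMetric x y < r → dist x y < s := by
  have hx := hX x
  refine ⟨Real.log ((boundaryDist x + s) / boundaryDist x),
    Real.log_pos ((one_lt_div hx).2 (by linarith)), fun y hy => ?_⟩
  have hg := gauge_pos hX x y
  rw [hypMetric_eq hX, Real.log_div (by positivity) hx.ne'] at hy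
  have h1 := Real.log_le_log (hX y) (boundaryDist_le_gauge_right x y)
  have h2 : gauge x y < boundaryDist x + s :=
    (Real.log_lt_log_iff hg (by positivity)).1 (by linarith)
  have h3 := le_max_left (boundaryDist x) (boundaryDist y)
  rw [gauge] at h2
  linarith

theorem isNatural_boundaryEquiv (hb : ¬ Bornology.IsBounded (Set.univ : Set X))
    (hX : ∀ x : X, 0 < boundaryDist x) : IsNatural (boundaryEquiv hb hX) := by
  refine continuous_def.2 fun U hU => ⟨fun x hx => ?_, fun ζ hζ w => ?_⟩
  · obtain ⟨s, hs, hsU⟩ := Metric.isOpen_iff.1 hU.1 (x : UniformSpace.Completion X) hx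
    obtain ⟨r, hr, h⟩ := exists_forall_hypMetric_lt hX x hs
    refine ⟨r, hr, fun y hy => hsU ?_⟩
    rw [Metric.mem_ball, UniformSpace.Completion.dist_eq, dist_comm]
    exact h y hy
  -- `V` is a neighbourhood of the end in `X` such that `U` contains `V` and all ends which are
  -- limits of sequences in `V`
  obtain ⟨V, hV, hVU, hVend⟩ : ∃ V ∈ endFilter (boundaryEquiv hb hX ζ),
      (∀ x ∈ V, ExtendedCompletion.pt (x : UniformSpace.Completion X) ∈ U) ∧
      ∀ (η : GromovBoundary (hypMetric (X := X))) (u : ℕ → X), u ∈ η.seqs →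
        (∀ᶠ i in atTop, u i ∈ V) → GromovClosure.bd η ∈ extendId (boundaryEquiv hb hX) ⁻¹' U := by
    simp only [Set.mem_preimage, extendId, mem_seqs_iff hb hX] at hζ ⊢
    cases ho : boundaryEquiv hb hX ζ with
    | some a =>
      rw [ho] at hζ
      obtain ⟨s, hs, hsU⟩ := Metric.nhds_basis_closedBall.mem_iff.1 (hU.1.mem_nhds hζ)
      refine ⟨_, preimage_mem_comap (Metric.closedBall_mem_nhds _ hs), fun x hx => hsU hx,
        fun η u hu huV => ?_⟩
      cases ho' : boundaryEquiv hb hX η with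
      | some c =>
        rw [ho'] at hu
        exact hsU (Metric.isClosed_closedBall.mem_of_tendsto (tendsto_endFilter_some.1 hu) huV)
      | none =>
        rw [ho', tendsto_endFilter_none w] at hu
        exfalso
        obtain ⟨i, hi, hi'⟩ := (huV.and (hu.eventually_gt_atTop
          (s + dist (a : UniformSpace.Completion X) w))).exists
        have h1 := dist_triangle (u i : UniformSpace.Completion X) a w
        rw [UniformSpace.Completion.dist_eq] at h1
        have h2 : dist (u i : UniformSpace.Completion X) a ≤ s := hi
        linarith
    | none =>
      rw [ho] at hζ
      obtain ⟨R, hR⟩ := (Metric.isBounded_iff_subset_ball (w : UniformSpace.Completion X)).1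
        (hU.2 hζ)
      have hR' : ∀ a : UniformSpace.Completion X, R ≤ dist a w → ExtendedCompletion.pt a ∈ U := by
        intro a ha
        by_contra hc
        exact (hR hc).not_ge ha
      refine ⟨{x | R ≤ dist x w}, (tendsto_dist_endFilter_none w).eventually_ge_atTop R,
        fun x hx => hR' _ (by rwa [UniformSpace.Completion.dist_eq]), fun η u hu huV => ?_⟩
      cases ho' : boundaryEquiv hb hX η with
      | some c =>
        rw [ho'] at hu
        exact hR' _ (ge_of_tendsto ((tendsto_dist_endFilter_some c w).comp hu) huV)
      | none => exact hζ
  obtain ⟨r, hr⟩ := exists_forall_lt_gromovProd_mem hX w _ hV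
  refine ⟨r, fun y hy => ?_⟩
  obtain ⟨v, hv⟩ := exists_seq_tendsto_endFilter hb (boundaryEquiv hb hX ζ)
  have hvζ := (mem_seqs_iff hb hX ζ v).2 hv
  cases y with
  | pt x =>
    have h1 := eventually_lt_of_lt_liminf (hy.trans_le (iInf₂_le v hvζ))
    obtain ⟨i, hi, hi'⟩ := ((hv.eventually hr).and h1).exists
    exact hVU x (hi x (EReal.coe_lt_coe_iff.1 hi'))
  | bd η =>
    obtain ⟨u, hu⟩ := exists_seq_tendsto_endFilter hb (boundaryEquiv hb hX η)
    have huη := (mem_seqs_iff hb hX η u).2 hu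
    have h1 := eventually_lt_of_lt_liminf (hy.trans_le ((iInf₂_le u huη).trans (iInf₂_le v hvζ)))
    refine hVend η u huη ?_
    filter_upwards [hv.eventually hr, h1] with i hi hi'
    exact hi _ (EReal.coe_lt_coe_iff.1 hi')

end Naturality

section Busemann

variable {X : Type*} [MetricSpace X]

/-! ### Busemann functions at infinity and the Hamenstädt kernel -/

theorem gromovProdPt_infty (hb : ¬ Bornology.IsBounded (Set.univ : Set X))
    (hX : ∀ x : X, 0 < boundaryDist x) (w a : X) {ξ : GromovBoundary (hypMetric (X := X))}
    (hξ : boundaryEquiv hb hX ξ = none) :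
    gromovProdPt hypMetric w a ξ =
      ((Real.log (gauge a w) - Real.log (boundaryDist w) : ℝ) : EReal) := by
  have hS := mem_seqs_iff hb hX ξ
  rw [hξ] at hS
  have hne : ξ.seqs.Nonempty := by
    obtain ⟨u, hu⟩ := exists_seq_tendsto_endFilter hb (none : Option (metricBoundary X))
    exact ⟨u, (hS u).2 hu⟩
  refine (biInf_congr fun v hv => ?_).trans (biInf_const hne)
  refine (EReal.tendsto_coe.2 ?_).liminf_eq
  have h0 : Tendsto (fun i => Real.log (gauge (v i) w / gauge (v i) a)) atTop (𝓝 0) := by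
    rw [← Real.log_one]
    exact ((Real.continuousAt_log one_ne_zero).tendsto.comp
      (tendsto_gauge_div_gauge hX w a)).comp ((hS v).1 hv)
  have h1 := h0.const_add (Real.log (gauge a w) - Real.log (boundaryDist w))
  rw [add_zero] at h1
  refine h1.congr fun i => ?_
  rw [gromovProd_hypMetric hX, gauge_comm a (v i),
    Real.log_div (gauge_pos hX _ _).ne' (gauge_pos hX _ _).ne']
  ring

theorem busemann_infty (hb : ¬ Bornology.IsBounded (Set.univ : Set X))
    (hX : ∀ x : X, 0 < boundaryDist x) (w x : X) {ξ : GromovBoundary (hypMetric (X := X))}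
    (hξ : boundaryEquiv hb hX ξ = none) :
    busemann hypMetric ξ w x = Real.log (boundaryDist w) - Real.log (boundaryDist x) := by
  rw [busemann, gromovProdPt_infty hb hX _ _ hξ, gromovProdPt_infty hb hX _ _ hξ,
    EReal.toReal_coe, EReal.toReal_coe, gauge_comm]
  ring

/-- With respect to a Busemann function at infinity, the Hamenstädt kernel is a power of a
multiple of the metric of `∂X`. -/
theorem rhoAt_busemann_infty (hb : ¬ Bornology.IsBounded (Set.univ : Set X))
    (hX : ∀ x : X, 0 < boundaryDist x) {ε : ℝ} (hε : 0 < ε) (w : X) (b : X → ℝ)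
    (hbw : ∀ x, b x = Real.log (boundaryDist w) - Real.log (boundaryDist x))
    {ζ₁ ζ₂ : GromovBoundary (hypMetric (X := X))} {a c : metricBoundary X}
    (ha : boundaryEquiv hb hX ζ₁ = some a) (hc : boundaryEquiv hb hX ζ₂ = some c) :
    rhoAt hypMetric b ε ζ₁ ζ₂ = ENNReal.ofReal ((dist a c / boundaryDist w) ^ ε) := by
  have hw := hX w
  have hS₁ := mem_seqs_iff hb hX ζ₁
  have hS₂ := mem_seqs_iff hb hX ζ₂
  rw [ha] at hS₁
  rw [hc] at hS₂
  have hne₁ : ζ₁.seqs.Nonempty := by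
    obtain ⟨u, hu⟩ := exists_seq_tendsto_endFilter hb (some a)
    exact ⟨u, (hS₁ u).2 hu⟩
  have hne₂ : ζ₂.seqs.Nonempty := by
    obtain ⟨u, hu⟩ := exists_seq_tendsto_endFilter hb (some c)
    exact ⟨u, (hS₂ u).2 hu⟩
  have hprod : ∀ x y, prodAt hypMetric b x y =
      Real.log (boundaryDist w) - Real.log (gauge x y) := by
    intro x y
    rw [prodAt, hbw, hbw, hypMetric_eq hX]
    ring
  have hlim : ∀ u ∈ ζ₁.seqs, ∀ v ∈ ζ₂.seqs,
      Tendsto (fun i => gauge (u i) (v i)) atTop (𝓝 (dist a c)) := fun u hu v hv =>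
    (tendsto_gauge_boundary a c).comp (((hS₁ u).1 hu).prodMk ((hS₂ v).1 hv))
  have hval : ∀ L : EReal, (∀ u ∈ ζ₁.seqs, ∀ v ∈ ζ₂.seqs,
      Tendsto (fun i => ((prodAt hypMetric b (u i) (v i) : ℝ) : EReal)) atTop (𝓝 L)) →
      prodAtBd hypMetric b ζ₁ ζ₂ = L := by
    intro L hL
    refine (biInf_congr fun u hu => ?_).trans (biInf_const hne₁)
    exact (biInf_congr fun v hv => (hL u hu v hv).liminf_eq).trans (biInf_const hne₂)
  rcases eq_or_ne a c with rfl | hac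
  · rw [rhoAt, hval ⊤, dist_self, zero_div, Real.zero_rpow hε.ne',
      EReal.coe_mul_top_of_pos hε, EReal.neg_top, EReal.exp_bot, ENNReal.ofReal_zero]
    intro u hu v hv
    refine EReal.tendsto_coe_nhds_top_iff.2 ?_
    simp_rw [hprod, sub_eq_add_neg]
    refine tendsto_atTop_add_const_left _ _ (tendsto_neg_atBot_atTop.comp ?_)
    refine Real.tendsto_log_nhdsGT_zero.comp (tendsto_nhdsWithin_iff.2 ⟨?_, ?_⟩)
    · simpa using hlim u hu v hv
    · exact Eventually.of_forall fun i => gauge_pos hX _ _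
  · have hd : 0 < dist a c := dist_pos.2 hac
    rw [rhoAt, hval ((Real.log (boundaryDist w) - Real.log (dist a c) : ℝ) : EReal),
      ← EReal.coe_mul, ← EReal.coe_neg, EReal.exp_coe, Real.rpow_def_of_pos (div_pos hd hw),
      Real.log_div hd.ne' hw.ne']
    · congr 2
      ring
    · intro u hu v hv
      refine EReal.tendsto_coe.2 ?_
      simp_rw [hprod]
      exact ((Real.continuousAt_log hd.ne').tendsto.comp (hlim u hu v hv)).const_sub _

/-- Hyperbolicity at quadruples of three points tending to `∂X` and one point tending to `∞`. -/
theorem dist_le_exp_mul_max (hb : ¬ Bornology.IsBounded (Set.univ : Set X))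
    (hX : ∀ x : X, 0 < boundaryDist x) {δ : ℝ} (hδ : IsHyperbolic (hypMetric (X := X)) δ)
    (a c e : metricBoundary X) :
    dist a c ≤ Real.exp δ * max (dist a e) (dist e c) := by
  have h := gauge_pos hX
  have := endFilter_neBot hb (none : Option (metricBoundary X))
  have key : ∀ x y z : X, gauge x y ≤ Real.exp δ * max (gauge x z) (gauge z y) := by
    intro x y z
    have h1 := ((tendsto_gauge_div_gauge hX y z).const_mul (gauge x z)).max
      ((tendsto_gauge_div_gauge hX x z).mul_const (gauge z y))
    have h2 := h1.const_mul (Real.exp δ)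
    rw [mul_one, one_mul] at h2
    refine ge_of_tendsto h2 (Eventually.of_forall fun w => ?_)
    have h3 := (min_gromovProd_sub_le_iff hX δ x y z w).1 (hδ.2 x y z w)
    have hz := h w z
    rw [← div_le_div_iff_of_pos_right hz, gauge_comm z w, mul_div_cancel_right₀ _ hz.ne',
      mul_div_assoc, ← max_div_div_right hz.le, mul_div_assoc, mul_div_right_comm,
      gauge_comm y w, gauge_comm x w, gauge_comm y z] at h3
    exact h3
  obtain ⟨x, hx⟩ := exists_seq_tendsto_endFilter hb (some a)
  obtain ⟨y, hy⟩ := exists_seq_tendsto_endFilter hb (some c)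
  obtain ⟨z, hz⟩ := exists_seq_tendsto_endFilter hb (some e)
  exact le_of_tendsto_of_tendsto' ((tendsto_gauge_boundary a c).comp (hx.prodMk hy))
    ((((tendsto_gauge_boundary a e).comp (hx.prodMk hz)).max
      ((tendsto_gauge_boundary e c).comp (hz.prodMk hy))).const_mul _)
    fun i => key (x i) (y i) (z i)

end Busemann

section Chain

/-! ### Chain metrics -/

variable {Y : Type*}

/-- The infimum of the sums `∑ ρ (c i) (c (i + 1))` over all finite chains from `x` to `y` with at
least one step. -/
noncomputable def chainInf (ρ : Y → Y → ℝ≥0∞) (x y : Y) : ℝ≥0∞ :=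
  ⨅ (n : ℕ) (c : ℕ → Y) (_ : 1 ≤ n ∧ c 0 = x ∧ c n = y),
    ∑ i ∈ Finset.range n, ρ (c i) (c (i + 1))

theorem chainInf_le (ρ : Y → Y → ℝ≥0∞) {n : ℕ} (hn : 1 ≤ n) (c : ℕ → Y) :
    chainInf ρ (c 0) (c n) ≤ ∑ i ∈ Finset.range n, ρ (c i) (c (i + 1)) :=
  (iInf₂_le n c).trans (iInf_le _ ⟨hn, rfl, rfl⟩)

theorem le_chainInf {ρ : Y → Y → ℝ≥0∞} {x y : Y} {L : ℝ≥0∞}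
    (h : ∀ (n : ℕ) (c : ℕ → Y), 1 ≤ n → c 0 = x → c n = y →
      L ≤ ∑ i ∈ Finset.range n, ρ (c i) (c (i + 1))) : L ≤ chainInf ρ x y :=
  le_iInf₂ fun n c => le_iInf fun hc => h n c hc.1 hc.2.1 hc.2.2

theorem chainInf_le_self (ρ : Y → Y → ℝ≥0∞) (x y : Y) : chainInf ρ x y ≤ ρ x y := by
  simpa using chainInf_le ρ le_rfl (fun i : ℕ => if i = 0 then x else y)

theorem chainInf_comm {ρ : Y → Y → ℝ≥0∞} (hρ : ∀ x y, ρ x y = ρ y x) (x y : Y) :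
    chainInf ρ x y = chainInf ρ y x := by
  have key : ∀ x y, chainInf ρ x y ≤ chainInf ρ y x := by
    refine fun x y => le_chainInf ?_
    rintro n c hn rfl rfl
    have h := chainInf_le ρ hn (fun i => c (n - i))
    rw [← Finset.sum_range_reflect] at h
    simp only [Nat.sub_zero, Nat.sub_self] at h
    refine h.trans_eq (Finset.sum_congr rfl fun i hi => ?_)
    have hi := Finset.mem_range.1 hi
    rw [hρ, show n - (n - 1 - i + 1) = i by omega, show n - (n - 1 - i) = i + 1 by omega]
  exact le_antisymm (key x y) (key y x)

theorem chainInf_triangle (ρ : Y → Y → ℝ≥0∞) (x y z : Y) :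
    chainInf ρ x z ≤ chainInf ρ x y + chainInf ρ y z := by
  rw [← tsub_le_iff_right]
  refine le_chainInf fun n c hn hc0 hcn => ?_
  rw [tsub_le_iff_right, ← tsub_le_iff_left]
  refine le_chainInf fun k e hk he0 hek => ?_
  rw [tsub_le_iff_left]
  have h := chainInf_le ρ (hn.trans (Nat.le_add_right n k))
    (fun i => if i ≤ n then c i else e (i - n))
  simp only [zero_le, if_true, hc0, show ¬ n + k ≤ n by omega, if_false, Nat.add_sub_cancel_left,
    hek] at h
  rw [Finset.sum_range_add] at h
  refine h.trans_eq (congrArg₂ _ (Finset.sum_congr rfl fun i hi => ?_)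
    (Finset.sum_congr rfl fun i _ => ?_))
  · have hi := Finset.mem_range.1 hi
    rw [if_pos hi.le, if_pos (show i + 1 ≤ n by omega)]
  · rw [if_neg (show ¬ n + i + 1 ≤ n by omega), show n + i + 1 - n = i + 1 by omega]
    rcases Nat.eq_zero_or_pos i with rfl | hi
    · simp [hcn, he0]
    · rw [if_neg (show ¬ n + i ≤ n by omega), Nat.add_sub_cancel_left]

/-- Frink's metrization lemma for the chain infimum of a quasimetric. -/
theorem exists_metricSpace_edist_eq_chainInf (d : Y → Y → ℝ≥0) (hself : ∀ x, d x x = 0)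
    (hzero : ∀ x y, d x y = 0 → x = y) (hcomm : ∀ x y, d x y = d y x)
    (hd : ∀ x₁ x₂ x₃ x₄, d x₁ x₄ ≤ 2 * max (d x₁ x₂) (max (d x₂ x₃) (d x₃ x₄))) :
    ∃ _M : MetricSpace Y, (∀ x y : Y, edist x y = chainInf (fun x y => (d x y : ℝ≥0∞)) x y) ∧
      ∀ x y : Y, dist x y ≤ d x y ∧ d x y ≤ 2 * dist x y := by
  set ρ : Y → Y → ℝ≥0∞ := fun x y => (d x y : ℝ≥0∞) with hρ
  have hle : ∀ x y, chainInf ρ x y ≤ d x y := chainInf_le_self ρ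
  have hge : ∀ x y, (d x y : ℝ≥0∞) ≤ 2 * chainInf ρ x y := by
    intro x y
    rw [mul_comm, ← ENNReal.div_le_iff_le_mul (by simp) (by simp)]
    refine le_chainInf ?_
    rintro n c - rfl rfl
    rw [ENNReal.div_le_iff_le_mul (by simp) (by simp)]
    -- the largest pseudometric below `d` is at least `d / 2`
    let _ := PseudoMetricSpace.ofPreNNDist d hself hcomm
    have h1 := PseudoMetricSpace.le_two_mul_dist_ofPreNNDist d hself hcomm hd (c 0) (c n)
    have h2 : ∀ x y, dist x y ≤ d x y := PseudoMetricSpace.dist_ofPreNNDist_le d hself hcomm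
    have h3 : dist (c 0) (c n) ≤ ∑ i ∈ Finset.range n, (d (c i) (c (i + 1)) : ℝ) :=
      (dist_le_range_sum_dist c n).trans (Finset.sum_le_sum fun i _ => h2 _ _)
    have h4 : d (c 0) (c n) ≤ (∑ i ∈ Finset.range n, d (c i) (c (i + 1))) * 2 := by
      rw [← NNReal.coe_le_coe]
      push_cast
      linarith
    simp only [hρ]
    exact_mod_cast h4
  let E : EMetricSpace Y :=
    { edist := chainInf ρ
      edist_self := fun x => le_antisymm ((hle x x).trans_eq (by simp [hself])) zero_le
      edist_comm := chainInf_comm fun x y => congrArg _ (hcomm x y)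
      edist_triangle := chainInf_triangle ρ
      eq_of_edist_eq_zero := fun {x y} h => hzero x y (by
        have := hge x y
        rw [show chainInf ρ x y = 0 from h, mul_zero] at this
        exact_mod_cast le_antisymm this zero_le) }
  have hfin : ∀ x y : Y, edist x y ≠ ⊤ := fun x y => ((hle x y).trans_lt ENNReal.coe_lt_top).ne
  refine ⟨EMetricSpace.toMetricSpace hfin, fun x y => rfl, fun x y => ⟨?_, ?_⟩⟩
  · exact ENNReal.toReal_mono ENNReal.coe_ne_top (hle x y)
  · have := ENNReal.toReal_mono (ENNReal.mul_ne_top (by simp) (hfin x y)) (hge x y)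
    rwa [ENNReal.toReal_mul] at this

end Chain

section Quasisymmetric

/-! ### Quasisymmetry of snowflake equivalences -/

theorem exists_homeomorph_mul_rpow {C p : ℝ} (hC : 0 < C) (hp : 0 < p) :
    ∃ η : ℝ≥0 ≃ₜ ℝ≥0, ∀ t : ℝ≥0, (η t : ℝ) = C * (t : ℝ) ^ p :=
  ⟨(NNReal.orderIsoRpow p hp).toHomeomorph.trans
    (Homeomorph.mulLeft₀ C.toNNReal (Real.toNNReal_pos.2 hC).ne'), fun t => by
    simp [hC.le]⟩

variable {A B : Type*} [MetricSpace A] [MetricSpace B]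

/-- A bijection which, up to a factor `2`, identifies the metric of `A` with a power of a multiple
of the metric of `B` is quasisymmetric in both directions. -/
theorem isQuasisymmetric_of_dist_rpow {ε k C : ℝ} (hε : 0 < ε) (hk : 0 < k) (f : A ≃ B)
    (hle : ∀ x y, dist x y ≤ (dist (f x) (f y) / k) ^ ε)
    (hge : ∀ x y, (dist (f x) (f y) / k) ^ ε ≤ 2 * dist x y)
    (hC₁ : 2 ^ (1 / ε) ≤ C) (hC₂ : 2 ≤ C) (η θ : ℝ≥0 ≃ₜ ℝ≥0)
    (hη : ∀ t : ℝ≥0, (η t : ℝ) = C * (t : ℝ) ^ (1 / ε))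
    (hθ : ∀ t : ℝ≥0, (θ t : ℝ) = C * (t : ℝ) ^ ε) :
    IsQuasisymmetric η f ∧ IsQuasisymmetric θ f.symm := by
  have hε' : 0 < 1 / ε := one_div_pos.2 hε
  have hf : ∀ x y, dist (f x) (f y) ≤ k * (2 * dist x y) ^ (1 / ε) := by
    intro x y
    have h0 : 0 ≤ dist (f x) (f y) / k := by positivity
    have h1 := Real.rpow_le_rpow (by positivity) (hge x y) hε'.le
    rw [← Real.rpow_mul h0, mul_one_div_cancel hε.ne', Real.rpow_one, div_le_iff₀ hk] at h1
    linarith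
  have hcont : Continuous f := by
    refine continuous_iff_continuousAt.2 fun x => tendsto_iff_dist_tendsto_zero.2 ?_
    refine squeeze_zero (fun _ => dist_nonneg) (fun y => hf y x) ?_
    have h : Continuous fun y => k * (2 * dist y x) ^ (1 / ε) :=
      continuous_const.mul ((continuous_const.mul (continuous_id.dist continuous_const)).rpow_const
        fun _ => Or.inr hε'.le)
    simpa [Real.zero_rpow (inv_pos.2 hε).ne'] using h.tendsto x
  have hcont' : Continuous f.symm := by
    refine continuous_iff_continuousAt.2 fun x => tendsto_iff_dist_tendsto_zero.2 ?_
    refine squeeze_zero (fun _ => dist_nonneg) (fun y => hle _ _) ?_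
    simp only [Equiv.apply_symm_apply]
    have h : Continuous fun y => (dist y x / k) ^ ε :=
      ((continuous_id.dist continuous_const).div_const k).rpow_const fun _ => Or.inr hε.le
    simpa [Real.zero_rpow hε.ne'] using h.tendsto x
  let F : A ≃ₜ B := ⟨f, hcont, hcont'⟩
  refine ⟨⟨F.isHomeomorph, fun t _ x y z h => ?_⟩, F.symm.isHomeomorph, fun t _ x y z h => ?_⟩
  · have h1 : 2 * dist x y ≤ 2 * (t : ℝ) * (dist (f x) (f z) / k) ^ ε := by
      have := mul_le_mul_of_nonneg_left (hle x z) t.coe_nonneg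
      linarith
    have h2 : (2 * dist x y) ^ (1 / ε) ≤
        2 ^ (1 / ε) * (t : ℝ) ^ (1 / ε) * (dist (f x) (f z) / k) := by
      refine (Real.rpow_le_rpow (by positivity) h1 hε'.le).trans_eq ?_
      rw [Real.mul_rpow (by positivity) (by positivity), Real.mul_rpow two_pos.le t.coe_nonneg,
        ← Real.rpow_mul (by positivity), mul_one_div_cancel hε.ne', Real.rpow_one]
    have h3 := (hf x y).trans (mul_le_mul_of_nonneg_left h2 hk.le)
    rw [hη]
    refine h3.trans ?_
    rw [show k * (2 ^ (1 / ε) * (t : ℝ) ^ (1 / ε) * (dist (f x) (f z) / k)) =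
      2 ^ (1 / ε) * (t : ℝ) ^ (1 / ε) * dist (f x) (f z) by field_simp]
    gcongr
  · have h1 := hle (f.symm x) (f.symm y)
    have h2 := hge (f.symm x) (f.symm z)
    simp only [Equiv.apply_symm_apply] at h1 h2
    have h3 : (dist x y / k) ^ ε ≤ (t : ℝ) ^ ε * (dist x z / k) ^ ε := by
      rw [← Real.mul_rpow t.coe_nonneg (by positivity)]
      refine Real.rpow_le_rpow (by positivity) ?_ hε.le
      rw [mul_div_assoc']
      exact div_le_div_of_nonneg_right h hk.le
    have h4 := mul_le_mul_of_nonneg_left h2 (Real.rpow_nonneg t.coe_nonneg ε)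
    rw [hθ]
    calc _ ≤ (t : ℝ) ^ ε * (2 * dist (f.symm x) (f.symm z)) := (h1.trans h3).trans h4
      _ = 2 * (t : ℝ) ^ ε * dist (f.symm x) (f.symm z) := by ring
      _ ≤ _ := by gcongr

end Quasisymmetric

section Punctured

variable {X : Type*} [MetricSpace X]

/-! ### The punctured boundary -/

theorem exists_puncturedEquiv {α β : Type*} (e : α ≃ Option β) :
    ∃ φ : {ζ : α // ζ ≠ e.symm none} ≃ β, ∀ ζ, e ζ.1 = some (φ ζ) := by
  have hsome : ∀ ζ : {ζ : α // ζ ≠ e.symm none}, ∃ a, e ζ.1 = some a := fun ζ =>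
    Option.ne_none_iff_exists'.1 fun h => ζ.2 (e.eq_symm_apply.2 h)
  choose g hg using hsome
  refine ⟨⟨g, fun a => ⟨e.symm (some a), fun h => by simpa using e.symm.injective h⟩,
    fun ζ => Subtype.ext ?_, fun a => ?_⟩, hg⟩
  · simp [← hg]
  · simpa using (hg ⟨e.symm (some a), fun h => by simpa using e.symm.injective h⟩).symm

/-- The Hamenstädt distance at `∞` is a metric comparable to its kernel. Of the bound
`exp (22 ε δ) ≤ 2` only `exp (2 ε δ) ≤ 2` matters: it is the quasimetric inequality for chains of
three steps that Frink's lemma requires. -/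
theorem exists_metricSpace_hamenstadt (hb : ¬ Bornology.IsBounded (Set.univ : Set X))
    (hX : ∀ x : X, 0 < boundaryDist x) {ε δ : ℝ} (hε : 0 < ε)
    (hδ : IsHyperbolic (hypMetric (X := X)) δ) (hεδ : Real.exp (22 * ε * δ) ≤ 2)
    {ξ : GromovBoundary (hypMetric (X := X))} (hξ : boundaryEquiv hb hX ξ = none)
    (φ : PuncturedBoundary (hypMetric (X := X)) ξ ≃ metricBoundary X)
    (hφ : ∀ ζ, boundaryEquiv hb hX ζ.1 = some (φ ζ)) {b : X → ℝ} {w : X}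
    (hbw : ∀ x, b x = busemann hypMetric ξ w x) :
    ∃ _M : MetricSpace (PuncturedBoundary (hypMetric (X := X)) ξ),
      (∀ ζ₁ ζ₂, edist ζ₁ ζ₂ = hamenstadt hypMetric ξ b ε ζ₁ ζ₂) ∧
      ∀ ζ₁ ζ₂ : PuncturedBoundary (hypMetric (X := X)) ξ,
        dist ζ₁ ζ₂ ≤ (dist (φ ζ₁) (φ ζ₂) / boundaryDist w) ^ ε ∧
        (dist (φ ζ₁) (φ ζ₂) / boundaryDist w) ^ ε ≤ 2 * dist ζ₁ ζ₂ := by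
  have hw := hX w
  have hbw' : ∀ x, b x = Real.log (boundaryDist w) - Real.log (boundaryDist x) := fun x =>
    (hbw x).trans (busemann_infty hb hX w x hξ)
  have hnn : ∀ a c : metricBoundary X, 0 ≤ (dist a c / boundaryDist w) ^ ε := fun a c => by
    positivity
  set d : PuncturedBoundary (hypMetric (X := X)) ξ → PuncturedBoundary (hypMetric (X := X)) ξ →
    ℝ≥0 := fun ζ₁ ζ₂ => ((dist (φ ζ₁) (φ ζ₂) / boundaryDist w) ^ ε).toNNReal with hd
  have hcoe : ∀ ζ₁ ζ₂, (d ζ₁ ζ₂ : ℝ) = (dist (φ ζ₁) (φ ζ₂) / boundaryDist w) ^ ε := fun _ _ =>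
    Real.coe_toNNReal _ (hnn _ _)
  have hham : hamenstadt hypMetric ξ b ε = chainInf fun ζ₁ ζ₂ => (d ζ₁ ζ₂ : ℝ≥0∞) := by
    change chainInf (fun ζ₁ ζ₂ : PuncturedBoundary (hypMetric (X := X)) ξ =>
      rhoAt hypMetric b ε ζ₁.1 ζ₂.1) = _
    congr 1
    funext ζ₁ ζ₂
    exact rhoAt_busemann_infty hb hX hε w b hbw' (hφ ζ₁) (hφ ζ₂)
  have hquad : ∀ x₁ x₂ x₃ x₄, d x₁ x₄ ≤ 2 * max (d x₁ x₂) (max (d x₂ x₃) (d x₃ x₄)) := by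
    intro x₁ x₂ x₃ x₄
    set m := max (dist (φ x₁) (φ x₂)) (max (dist (φ x₂) (φ x₃)) (dist (φ x₃) (φ x₄))) with hm
    have hm0 : 0 ≤ m := dist_nonneg.trans (le_max_left _ _)
    have hδ1 : 1 ≤ Real.exp δ := Real.one_le_exp hδ.1
    -- the three-point inequality, applied twice
    have h1 : dist (φ x₁) (φ x₄) ≤ Real.exp (2 * δ) * m := by
      have h2 : dist (φ x₂) (φ x₄) ≤ Real.exp δ * m :=
        (dist_le_exp_mul_max hb hX hδ _ _ (φ x₃)).trans
          (mul_le_mul_of_nonneg_left (le_max_right _ _) (Real.exp_pos δ).le)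
      have h3 : dist (φ x₁) (φ x₂) ≤ Real.exp δ * m :=
        (le_max_left _ _).trans (le_mul_of_one_le_left hm0 hδ1)
      refine (dist_le_exp_mul_max hb hX hδ _ _ (φ x₂)).trans
        ((mul_le_mul_of_nonneg_left (max_le h3 h2) (Real.exp_pos δ).le).trans_eq ?_)
      rw [two_mul, Real.exp_add]
      ring
    have h4 : (dist (φ x₁) (φ x₄) / boundaryDist w) ^ ε ≤ 2 * (m / boundaryDist w) ^ ε := by
      calc _ ≤ (Real.exp (2 * δ) * (m / boundaryDist w)) ^ ε := by
            rw [mul_div_assoc']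
            gcongr
        _ = Real.exp (2 * δ * ε) * (m / boundaryDist w) ^ ε := by
            rw [Real.mul_rpow (Real.exp_pos _).le (by positivity), Real.exp_mul (2 * δ)]
        _ ≤ 2 * (m / boundaryDist w) ^ ε := by
            have : Real.exp (2 * δ * ε) ≤ 2 := by
              refine (Real.exp_le_exp.2 ?_).trans hεδ
              have := mul_nonneg hδ.1 hε.le
              linarith
            gcongr
    have hmono : Monotone fun s : ℝ => ((max s 0 / boundaryDist w) ^ ε).toNNReal := by
      intro s t hst
      dsimp only
      gcongr
    have hmax : ∀ s t : ℝ, 0 ≤ s → 0 ≤ t → ((max s t / boundaryDist w) ^ ε).toNNReal =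
        max ((s / boundaryDist w) ^ ε).toNNReal ((t / boundaryDist w) ^ ε).toNNReal := by
      intro s t hs ht
      have := hmono.map_max (a := s) (b := t)
      simpa only [max_eq_left hs, max_eq_left ht, max_eq_left (hs.trans (le_max_left s t))]
        using this
    calc d x₁ x₄ ≤ (2 * (m / boundaryDist w) ^ ε).toNNReal := Real.toNNReal_le_toNNReal h4
      _ = 2 * max (d x₁ x₂) (max (d x₂ x₃) (d x₃ x₄)) := by
        rw [Real.toNNReal_mul two_pos.le, hm, hmax _ _ dist_nonneg
          (dist_nonneg.trans (le_max_left _ _)), hmax _ _ dist_nonneg dist_nonneg,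
          Real.toNNReal_ofNat]
  obtain ⟨M, hM, hMd⟩ := exists_metricSpace_edist_eq_chainInf d
    (fun x => by simp [hd, Real.zero_rpow hε.ne'])
    (fun x y h => by
      have h1 := hcoe x y
      rw [h, NNReal.coe_zero, eq_comm,
        Real.rpow_eq_zero (div_nonneg dist_nonneg hw.le) hε.ne', div_eq_zero_iff] at h1
      exact φ.injective (dist_eq_zero.1 (h1.resolve_right hw.ne')))
    (fun x y => by simp only [hd, dist_comm]) hquad
  refine ⟨M, fun ζ₁ ζ₂ => (hM ζ₁ ζ₂).trans (congrFun₂ hham ζ₁ ζ₂).symm, fun ζ₁ ζ₂ => ?_⟩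
  rw [← hcoe]
  exact hMd ζ₁ ζ₂

end Punctured

end Hyperbolization

theorem theorem1p1 (ε : ℝ) (hε : 0 < ε) :
    ∃ (C : ℝ) (η θ : ℝ≥0 ≃ₜ ℝ≥0), 0 < C ∧
      (∀ t : ℝ≥0, (η t : ℝ) = C * (t : ℝ) ^ (1 / ε)) ∧
      (∀ t : ℝ≥0, (θ t : ℝ) = C * (t : ℝ) ^ ε) ∧
      ∀ (X : Type*) [MetricSpace X],
        ¬ Bornology.IsBounded (Set.univ : Set X) → ¬ CompleteSpace X →
        (∀ x : X, 0 < boundaryDist x) →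
        IsMetric (hypMetric (X := X)) ∧
        IsHyperbolic (hypMetric (X := X)) (Real.log 4) ∧
        ∃ (ψ : GromovBoundary (hypMetric (X := X)) →
            Option (metricBoundary X))
          (ξ : GromovBoundary (hypMetric (X := X)))
          (φ : PuncturedBoundary (hypMetric (X := X)) ξ ≃
            metricBoundary X),
          IsNatural ψ ∧ Function.Bijective ψ ∧ ψ ξ = none ∧
          (∀ ζ : PuncturedBoundary (hypMetric (X := X)) ξ,
            ψ ζ.1 = some (φ ζ)) ∧
          ∀ δ : ℝ, IsHyperbolic (hypMetric (X := X)) δ →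
            Real.exp (22 * ε * δ) ≤ 2 →
            ∀ b : X → ℝ, IsBusemann hypMetric ξ b →
              ∃ _M : MetricSpace
                  (PuncturedBoundary (hypMetric (X := X)) ξ),
                (∀ ζ₁ ζ₂, edist ζ₁ ζ₂ =
                  hamenstadt hypMetric ξ b ε ζ₁ ζ₂) ∧
                IsQuasisymmetric η φ ∧
                IsQuasisymmetric θ φ.symm := by
  have hC₀ : (0 : ℝ) < 2 ^ (1 / ε) := by positivity
  have hC : (0 : ℝ) < 2 ^ (1 / ε) + 2 := by positivity
  obtain ⟨η, hη⟩ := exists_homeomorph_mul_rpow hC (one_div_pos.2 hε)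
  obtain ⟨θ, hθ⟩ := exists_homeomorph_mul_rpow hC hε
  refine ⟨2 ^ (1 / ε) + 2, η, θ, hC, hη, hθ, fun X _ hb _ hX => ⟨isMetric_hypMetric hX,
    isHyperbolic_hypMetric hX, ?_⟩⟩
  obtain ⟨φ, hφ⟩ := exists_puncturedEquiv (boundaryEquiv hb hX)
  have hξ := (boundaryEquiv hb hX).apply_symm_apply none
  refine ⟨boundaryEquiv hb hX, _, φ, isNatural_boundaryEquiv hb hX,
    (boundaryEquiv hb hX).bijective, hξ, hφ, ?_⟩
  rintro δ hδ hεδ b ⟨w, hbw⟩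
  obtain ⟨M, hM, hMd⟩ := exists_metricSpace_hamenstadt hb hX hε hδ hεδ hξ φ hφ hbw
  exact ⟨M, hM, isQuasisymmetric_of_dist_rpow hε (hX w) φ (fun x y => (hMd x y).1)
    (fun x y => (hMd x y).2) (by linarith) (by linarith) η θ hη hθ⟩
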